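/- Let $f(x)=\tfrac12 x^{\top}Qx+q^{\top}x$ on $\mathbb{R}^n$ with $Q\in\mathbb{R}^{n\times n}$ symmetric positive semidefinite and $q\in\mathbb{R}^n$, and let $L_f=\lambda_{\max}(Q)$. Let $g:\mathbb{R}^n\to\mathbb{R}\cup\{+\infty\}$ be proper, closed and convex, let $F=f+g$, and assume that the set of minimizers of $F$ is nonempty; let $F_\star=\min F$. For $\gamma>0$ let $\operatorname{prox}_{\gamma h}(x)=\operatorname{argmin}_z\{h(z)+\tfrac1{2\gamma}\|z-x\|^2\}$. Suppose $0<\gamma<1/L_f$ (with $1/0=+\infty$), put $$\lambda=\frac{1-\gamma L_f}{1+\gamma L_f},\qquad \beta_0=0,\qquad \beta_k=\frac{k-1}{k+2}\quad(k\ge 1),$$ and, given $u^0=x^0\in\mathbb{R}^n$, let the sequences be generated for $k=0,1,2,\dots$ by fast Douglas–Rachford splitting $$y^k=\operatorname{prox}_{\gamma f}(u^k),\quad z^k=\operatorname{prox}_{\gamma g}(2y^k-u^k),\quad x^{k+1}=u^k+\lambda(z^k-y^k),\quad u^{k+1}=x^{k+1}+\beta_k(x^{k+1}-x^k).$$ Let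 $\tilde x$ be any solution of $\operatorname{prox}_{\gamma g}(2\operatorname{prox}_{\gamma f}(\tilde x)-\tilde x)=\operatorname{prox}_{\gamma f}(\tilde x)$. Then for every $k\ge 0$ $$F(z^k)-F_\star\le\frac{2}{\gamma\lambda(k+2)^2}\,\|x^0-\tilde x\|^2 .$$ -/

import Mathlib

noncomputable section

/-- The Euclidean space `ℝⁿ`. -/
abbrev Rn (n : ℕ) : Type := EuclideanSpace ℝ (Fin n)

/-- An extended-real-valued function on `ℝⁿ` is proper, closed (lower semicontinuous) and convex.
Convexity is convexity of the epigraph. -/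
structure IsProperClosedConvex {n : ℕ} (h : Rn n → EReal) : Prop where
  ne_bot : ∀ x, h x ≠ ⊥
  exists_ne_top : ∃ x, h x ≠ ⊤
  closed : LowerSemicontinuous h
  convex : Convex ℝ {p : Rn n × ℝ | h p.1 ≤ (p.2 : EReal)}

/-- The set of (global) minimizers of an extended-real-valued function. -/
def argminSet {n : ℕ} (h : Rn n → EReal) : Set (Rn n) :=
  {x | ∀ z, h x ≤ h z}

/-- The proximal mapping: `prox_{γh}(x) = argmin_z { h(z) + ‖z - x‖² / (2γ) }`, as a set of
minimizers (it has exactly one element when `h` is proper, closed and convex and `γ > 0`). -/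
def proxSet {n : ℕ} (γ : ℝ) (h : Rn n → EReal) (x : Rn n) : Set (Rn n) :=
  argminSet fun z => h z + ((1 / (2 * γ) * ‖z - x‖ ^ 2 : ℝ) : EReal)

/-- The quadratic function `f(x) = ½ x'Qx + q'x`. -/
def quadFun {n : ℕ} (Q : Matrix (Fin n) (Fin n) ℝ) (q : Rn n) (x : Rn n) : ℝ :=
  1 / 2 * (x.ofLp ⬝ᵥ Q.mulVec x.ofLp) + q.ofLp ⬝ᵥ x.ofLp

/-- `quadFun` as an extended-real-valued function. -/
def quadFunE {n : ℕ} (Q : Matrix (Fin n) (Fin n) ℝ) (q : Rn n) (x : Rn n) : EReal :=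
  (quadFun Q q x : EReal)

/-- The largest eigenvalue of a real symmetric matrix. -/
def lambdaMax {n : ℕ} (Q : Matrix (Fin n) (Fin n) ℝ) : ℝ :=
  sSup (spectrum ℝ Q)

/-- The set of solutions `x` of `prox_{γg}(2 prox_{γf}(x) - x) - prox_{γf}(x) = 0`. -/
def drsFixedSet {n : ℕ} (γ : ℝ) (f g : Rn n → EReal) : Set (Rn n) :=
  {x | ∃ p, p ∈ proxSet γ f x ∧ p ∈ proxSet γ g ((2 : ℝ) • p - x)}

/-- The sequences `x, u, y, z` are generated by fast Douglas-Rachford splitting for `f + g` with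
parameter `γ`, stepsizes `lam k` and extrapolation coefficients `β k`, started at `x 0`. -/
structure IsFastDRS {n : ℕ} (f g : Rn n → EReal) (γ : ℝ) (lam β : ℕ → ℝ)
    (x u y z : ℕ → Rn n) : Prop where
  init : u 0 = x 0
  y_step : ∀ k, y k ∈ proxSet γ f (u k)
  z_step : ∀ k, z k ∈ proxSet γ g ((2 : ℝ) • y k - u k)
  x_step : ∀ k, x (k + 1) = u k + lam k • (z k - y k)
  u_step : ∀ k, u (k + 1) = x (k + 1) + β k • (x (k + 1) - x k)

/-- The extrapolation coefficients `β₀ = 0` and `β_k = (k - 1) / (k + 2)` for `k > 0`. -/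
def fastBeta (k : ℕ) : ℝ :=
  if k = 0 then 0 else ((k : ℝ) - 1) / ((k : ℝ) + 2)

/-- The stepsize `λ = (1 - γ L) / (1 + γ L)`. -/
def drsStep (γ L : ℝ) : ℝ := (1 - γ * L) / (1 + γ * L)

end

/-!
In suitable coordinates and a suitable metric, fast Douglas–Rachford splitting is an accelerated
proximal point method; its rate comes from a potential function adapted to the final index.

**Reduction.** Put `K = γQ` and `T = 1 + K`. The map `prox_{γf}` inverts `y ↦ T y + γq`
(`prox_quadFun_eq`), so the change of variables `x = T a + γq` turns the iteration into
`a (k+1) = y k + λ b k` with `T (b k) = z k - y k`, and `y (k+1)` extrapolates the `a`'s. The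
condition `γ L_f < 1` enters through `‖K v‖² ≤ ⟪K v, v⟫` and `0 < λ ≤ 1`. Let `N(u, v) = ⟪u, v⟫ - ⟪K u, K v⟫`
(`defectForm`). The subgradient inequality of the second proximal step, added to the exact second
order expansion of `f`, gives `γ (F(z) - F(v)) ≤ N(b, v - z)` for every `v` (`objective_sub_le`).
Since `z k - a (k+1) = (T - λ) (b k)`, the energy `E k = F(z k) + N(b k, (T - λ) (b k)) / (2γ)`,
which dominates `F(z k)`, satisfies
* `γλ (E k - F⋆) ≤ N(a (k+1) - y k, p - a (k+1))`,
* `γλ (E (k+1) - E k) ≤ N(a (k+2) - y (k+1), a (k+1) - a (k+2))`,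

where `p = prox_{γf}(x̃)` minimizes `F`. These are the inequalities of an accelerated proximal
point method in the seminorm of `N`; the final distance is compared by `N(v, v) ≤ ‖T v‖²`.

**Rate.** The step from `x (k+1)` to `u (k+1)` uses `β k = (k-1)/(k+2)`, so the usual potential
with weights `(k+1)/2` only yields `(k+1)²` in the denominator. The factor `(N+2)²` at a given
index `N ≥ 2` is reached by weights `t 0 = 1`, `t k = (k+1)/2 + C (k+1) k (k-1)`. The cubic term solves the
homogeneous part of the recursion `β k * t (k+1) = t k - 1` that the extrapolation forces on the
weights, and `C` depends on `N`. With `A k = t 0 + … + t k`, the quantity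
`A k δ k + ‖r‖²/2 - (t k - 1) ⟪r, m⟫ + β k A (k+1) ‖m‖²/2`, `r = a (k+1) - p`,
`m = a k - a (k+1)`, does not increase for `k < N`, where `δ k = γλ (E k - F⋆)` and norms
and products are those of `N(·, ·)`; the last step only changes the coefficient of `‖m‖²`. Since
`A N = (N+2)²/4`, this is the rate (`accelerated_step`, `accelerated_bound`, `accelerated_rate`).
-/

open scoped RealInnerProductSpace

/-! ### Accelerated proximal point recursions in a semi-inner product -/

section BilinForm

variable {E : Type*} [AddCommGroup E] [Module ℝ E] {B : LinearMap.BilinForm ℝ E}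

/-- One step of the potential argument: `r` and `m` are the new error and the new displacement, `w`
is the previous displacement, `c` the extrapolation coefficient. The terms in `⟪r, m⟫` and
`⟪r, w⟫` match exactly; the form in `m` and `w` that remains is
`c * (A + t) / 2 * ‖m - w‖²` plus half the slack of `hX` times `‖m‖²`. -/
theorem accelerated_step (hs : ∀ u v, B u v = B v u) (hn : ∀ u, 0 ≤ B u u)
    {A t c X δ δ' : ℝ} {r m w : E} (hA : 0 ≤ A) (ht : 0 ≤ t) (hc : 0 ≤ c)
    (hX : X + c * (A + t) ≤ 1 + 2 * A)
    (hP : δ ≤ B (m - c • w) r) (hM : δ ≤ δ' - B (m - c • w) m) :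
    (A + t) * δ + (B r r / 2 - (t - 1) * B r m + X / 2 * B m m) ≤
      A * δ' + (B (r + m) (r + m) / 2 - c * t * B (r + m) w + c * (A + t) / 2 * B w w) := by
  have h1 := mul_le_mul_of_nonneg_left hP ht
  have h2 := mul_le_mul_of_nonneg_left hM hA
  have h3 := mul_nonneg (mul_nonneg hc (add_nonneg hA ht)) (hn (m - w))
  have h4 := mul_le_mul_of_nonneg_right hX (hn m)
  simp only [map_add, map_sub, map_smul, LinearMap.add_apply, LinearMap.sub_apply,
    LinearMap.smul_apply, smul_eq_mul] at h1 h2 h3 ⊢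
  rw [hs m r, hs w r] at *
  rw [hs w m] at *
  linarith

/-- Potential bound at the index `N` for weights `t` with partial sums `A`. The weights may depend on
`N`, since all conditions relating them to the extrapolation coefficients `β` are for indices
up to `N`. -/
theorem accelerated_bound (hs : ∀ u v, B u v = B v u) (hn : ∀ u, 0 ≤ B u u)
    {β A t δ : ℕ → ℝ} {a y : ℕ → E} {p : E} {N : ℕ}
    (hβ : ∀ k, 0 ≤ β k) (hβ0 : β 0 = 0) (ht : ∀ k, 0 ≤ t k) (ht0 : t 0 = 1) (hA0 : A 0 = 1)
    (hA : ∀ k < N, A (k + 1) = A k + t (k + 1))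
    (hβt : ∀ k < N, β k * t (k + 1) = t k - 1)
    (hstep : ∀ k, k + 1 < N →
      β (k + 1) * A (k + 2) + β k * A (k + 1) ≤ 1 + 2 * A k)
    (hlast : ∀ k, k + 1 = N → (t N - 1) ^ 2 + β k * A (k + 1) ≤ 1 + 2 * A k)
    (hy0 : y 0 = a 0)
    (hy : ∀ k, y (k + 1) = a (k + 1) + β k • (a (k + 1) - a k))
    (hP : ∀ k, δ k ≤ B (a (k + 1) - y k) (p - a (k + 1)))
    (hM : ∀ k, δ (k + 1) ≤ δ k + B (a (k + 2) - y (k + 1)) (a (k + 1) - a (k + 2))) :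
    A N * δ N ≤ B (a 0 - p) (a 0 - p) / 2 := by
  have hApos : ∀ k ≤ N, 0 ≤ A k := by
    intro k
    induction k with
    | zero => intro; rw [hA0]; norm_num
    | succ k ih =>
      intro h
      rw [hA k h]
      exact add_nonneg (ih (by omega)) (ht _)
  -- The coefficient `X` of `B m m` is free: it is `β (k + 1) * A (k + 2)` in the inductive steps
  -- and `(t N - 1) ^ 2`, the least value keeping the potential nonnegative, in the last one.
  have hadv : ∀ k < N, ∀ X, X + β k * A (k + 1) ≤ 1 + 2 * A k →
      A k * δ k + (B (a (k + 1) - p) (a (k + 1) - p) / 2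
        - (t k - 1) * B (a (k + 1) - p) (a k - a (k + 1))
        + β k * A (k + 1) / 2 * B (a k - a (k + 1)) (a k - a (k + 1)))
          ≤ B (a 0 - p) (a 0 - p) / 2 →
      A (k + 1) * δ (k + 1) + (B (a (k + 2) - p) (a (k + 2) - p) / 2
        - (t (k + 1) - 1) * B (a (k + 2) - p) (a (k + 1) - a (k + 2))
        + X / 2 * B (a (k + 1) - a (k + 2)) (a (k + 1) - a (k + 2)))
          ≤ B (a 0 - p) (a 0 - p) / 2 := by
    intro k hk X hX ih
    have e1 : a (k + 2) - y (k + 1)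
        = -((a (k + 1) - a (k + 2)) - β k • (a k - a (k + 1))) := by
      rw [hy]; module
    have e2 : a (k + 1) - p = (a (k + 2) - p) + (a (k + 1) - a (k + 2)) := by abel
    have e3 : p - a (k + 2) = -(a (k + 2) - p) := by abel
    have hP' := hP (k + 1)
    have hM' := hM k
    rw [show k + 1 + 1 = k + 2 from rfl, e1, e3, map_neg, map_neg, LinearMap.neg_apply,
      neg_neg] at hP'
    rw [e1, map_neg, LinearMap.neg_apply, ← sub_eq_add_neg] at hM'
    rw [hA k hk] at hX ih ⊢
    have := accelerated_step hs hn (hApos k hk.le) (ht (k + 1)) (hβ k) hX hP' hM'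
    rw [← e2, hβt k hk] at this
    exact this.trans ih
  have hbase : δ 0 + B (a 1 - p) (a 1 - p) / 2 + B (a 0 - a 1) (a 0 - a 1) / 2
      ≤ B (a 0 - p) (a 0 - p) / 2 := by
    have h := hP 0
    rw [hy0, zero_add, show p - a 1 = -(a 1 - p) by abel,
      show a 1 - a 0 = -(a 0 - a 1) by abel] at h
    rw [show a 0 - p = (a 1 - p) + (a 0 - a 1) by abel]
    simp only [map_add, map_neg, LinearMap.add_apply, LinearMap.neg_apply, neg_neg] at h ⊢
    rw [hs (a 1 - p) (a 0 - a 1)]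
    linarith
  rcases N with _ | N
  · rw [hA0, one_mul]
    linarith [hn (a 1 - p), hn (a 0 - a 1)]
  · have key : ∀ k ≤ N, A k * δ k + (B (a (k + 1) - p) (a (k + 1) - p) / 2
        - (t k - 1) * B (a (k + 1) - p) (a k - a (k + 1))
        + β k * A (k + 1) / 2 * B (a k - a (k + 1)) (a k - a (k + 1)))
          ≤ B (a 0 - p) (a 0 - p) / 2 := by
      intro k
      induction k with
      | zero =>
        intro _
        rw [hA0, ht0, hβ0]
        linarith [hn (a 0 - a 1)]
      | succ k ih =>
        intro hk
        exact hadv k (by omega) _ (hstep k (by omega)) (ih (by omega))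
    have h := hadv N (by omega) _ (hlast N rfl) (key N le_rfl)
    have hsq := hn ((a (N + 2) - p) - (t (N + 1) - 1) • (a (N + 1) - a (N + 2)))
    rw [show N + 1 + 1 = N + 2 from rfl] at h
    generalize a (N + 2) - p = r, a (N + 1) - a (N + 2) = m at h hsq
    simp only [map_sub, map_smul, LinearMap.sub_apply, LinearMap.smul_apply, smul_eq_mul,
      hs m r] at hsq
    linarith

/-- The rate `1 / (N + 2)²` for the coefficients `β k = (k - 1) / (k + 2)` used with a delay of one
index, by a choice of the weights in `accelerated_bound` that depends on `N`. -/
theorem accelerated_rate (hs : ∀ u v, B u v = B v u) (hn : ∀ u, 0 ≤ B u u)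
    {δ : ℕ → ℝ} {a y : ℕ → E} {p : E} (hy0 : y 0 = a 0)
    (hy : ∀ k, y (k + 1) = a (k + 1) + fastBeta k • (a (k + 1) - a k))
    (hP : ∀ k, δ k ≤ B (a (k + 1) - y k) (p - a (k + 1)))
    (hM : ∀ k, δ (k + 1) ≤ δ k + B (a (k + 2) - y (k + 1)) (a (k + 1) - a (k + 2))) (N : ℕ) :
    ((N : ℝ) + 2) ^ 2 / 4 * δ N ≤ B (a 0 - p) (a 0 - p) / 2 := by
  have hβ : ∀ k, 0 ≤ fastBeta k := by
    rintro (_ | k)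
    · simp [fastBeta]
    · simp only [fastBeta, Nat.add_eq_zero_iff, one_ne_zero, and_false, if_false, Nat.cast_succ,
        add_sub_cancel_right]
      positivity
  have hβ0 : fastBeta 0 = 0 := by simp [fastBeta]
  have hβs : ∀ k : ℕ, fastBeta (k + 1) = (k : ℝ) / (k + 3) := by
    intro k
    simp only [fastBeta, Nat.add_eq_zero_iff, one_ne_zero, and_false, if_false, Nat.cast_succ]
    congr 1 <;> ring
  -- For `N ≤ 1` the recursion does not constrain the last weight, and the partial sums can be
  -- taken to be `(k + 2) ^ 2 / 4` directly.
  obtain hN | hN := Nat.lt_or_ge N 2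
  · have h := accelerated_bound hs hn (A := fun k => ((k : ℝ) + 2) ^ 2 / 4)
      (t := fun k => 1 + (k : ℝ) / 4) (N := N) hβ hβ0 (fun k => by positivity) (by norm_num)
      (by norm_num)
      (fun k hk => by obtain rfl : k = 0 := by omega
                      norm_num)
      (fun k hk => by obtain rfl : k = 0 := by omega
                      norm_num [hβ0])
      (fun k hk => by omega)
      (fun k hk => by obtain rfl : k = 0 := by omega
                      subst hk
                      norm_num [hβ0]) hy0 hy hP hM
    exact h
  · obtain ⟨M, rfl⟩ : ∃ M, N = M + 2 := ⟨N - 2, by omega⟩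
    have hM0 : (0 : ℝ) ≤ M := M.cast_nonneg
    -- `C` is chosen so that `A N = (N + 2) ^ 2 / 4`.
    obtain ⟨C, hC⟩ : ∃ C : ℝ, C = 1 / (((M : ℝ) + 1) * (M + 3) * (M + 4)) := ⟨_, rfl⟩
    have hCM : C * (((M : ℝ) + 1) * (M + 3) * (M + 4)) = 1 := by rw [hC]; field_simp
    have hC0 : 0 ≤ C := by rw [hC]; positivity
    -- `t 0 = 1` is separate because `β 0 = 0` is not of the form `(k - 1) / (k + 2)`.
    let t : ℕ → ℝ := fun k => if k = 0 then 1 else ((k : ℝ) + 1) / 2 + C * ((k + 1) * k * (k - 1))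
    let A : ℕ → ℝ := fun k =>
      ((k : ℝ) ^ 2 + 3 * k + 4) / 4 + C * ((k + 2) * (k + 1) * k * (k - 1)) / 4
    have hts : ∀ k : ℕ, t (k + 1) = ((k : ℝ) + 2) / 2 + C * ((k + 2) * (k + 1) * k) := by
      intro k
      simp only [t, Nat.add_eq_zero_iff, one_ne_zero, and_false, if_false, Nat.cast_succ]
      ring
    have h := accelerated_bound hs hn (A := A) (t := t) (N := M + 2) hβ hβ0
      (by
        rintro (_ | k)
        · simp [t]
        · rw [hts]; positivity)
      (by simp [t]) (by simp [A])
      (by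
        intro k _
        rw [hts]
        simp only [A]
        push_cast
        ring)
      (by
        rintro (_ | k) _
        · simp [t, hβ0]
        · rw [hts, hts, hβs]
          push_cast
          field_simp
          ring)
      (by
        rintro (_ | k) hk
        · have := hβs 0
          simp only [Nat.cast_zero, zero_div, zero_add] at this
          norm_num [A, hβ0, this]
        · have hk : (k : ℝ) ≤ M := by exact_mod_cast (by omega : k ≤ M)
          have hk0 : (0 : ℝ) ≤ k := k.cast_nonneg
          have hprod : ((k : ℝ) + 1) * (k + 2) * (6 * k + 15)
              ≤ 11 * ((M + 1) * (M + 3) * (M + 4)) := by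
            have : ((k : ℝ) + 1) * (k + 2) * (6 * k + 15)
                ≤ (M + 1) * (M + 3) * (11 * (M + 4)) := by
              gcongr <;> linarith
            linarith
          have hCk := mul_le_mul_of_nonneg_left hprod hC0
          have hid : 4 * (1 + 2 * A (k + 1) - (fastBeta (k + 1 + 1) * A (k + 1 + 2)
              + fastBeta (k + 1) * A (k + 1 + 1)))
                = 11 + 6 / ((k : ℝ) + 3) + 6 / ((k : ℝ) + 4)
                  - C * (((k : ℝ) + 1) * (k + 2) * (6 * k + 15)) := by
            rw [hβs, hβs]
            simp only [A]
            push_cast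
            field_simp
            ring
          have h3 : 0 ≤ 6 / ((k : ℝ) + 3) := by positivity
          have h4 : 0 ≤ 6 / ((k : ℝ) + 4) := by positivity
          linarith)
      (by
        intro k hk
        obtain rfl : k = M + 1 := by omega
        have e1 : t (M + 1 + 1) - 1 = ((M : ℝ) + 1) / 2 + (M + 2) / (M + 4) := by
          rw [hts, hC]
          push_cast
          field_simp
          ring
        have e2 : A (M + 1 + 1) = ((M : ℝ) + 4) ^ 2 / 4 := by
          simp only [A, hC]
          push_cast
          field_simp
          ring
        have e3 : A (M + 1) = ((M : ℝ) ^ 2 + 5 * M + 8) / 4 + (M + 2) * M / (4 * (M + 4)) := by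
          simp only [A, hC]
          push_cast
          field_simp
          ring
        rw [e1, e2, e3, hβs, ← sub_nonneg]
        have : 1 + 2 * (((M : ℝ) ^ 2 + 5 * M + 8) / 4 + (M + 2) * M / (4 * (M + 4)))
            - ((((M : ℝ) + 1) / 2 + (M + 2) / (M + 4)) ^ 2 + M / (M + 3) * ((M + 4) ^ 2 / 4))
              = (M ^ 4 + 25 * M ^ 3 + 205 * M ^ 2 + 672 * M + 768) / (4 * (M + 3) * (M + 4) ^ 2) := by
          field_simp
          ring
        rw [this]
        positivity) hy0 hy hP hM
    have hAN : A (M + 2) = (((M + 2 : ℕ) : ℝ) + 2) ^ 2 / 4 := by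
      simp only [A]
      push_cast
      linear_combination ((M + 2) / 4 : ℝ) * hCM
    rwa [hAN] at h

end BilinForm

/-! ### The metric of the splitting method -/

section Inner

variable {E : Type*} [NormedAddCommGroup E] [InnerProductSpace ℝ E]

/-- The bilinear form `N(u, v) = ⟪u, v⟫ - ⟪K u, K v⟫`. For symmetric `K` it is the form of
`(1 - K)(1 + K)`, the metric in which the change of variables `x = (1 + K) a` turns the splitting
method into an accelerated proximal point method. -/
noncomputable def defectForm (K : E →ₗ[ℝ] E) : LinearMap.BilinForm ℝ E :=
  innerₗ E - (innerₗ E).compl₁₂ K K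

theorem defectForm_apply (K : E →ₗ[ℝ] E) (u v : E) :
    defectForm K u v = ⟪u, v⟫ - ⟪K u, K v⟫ := rfl

/-- The bilinear form `W(u, v) = N(u, (1 + K - λ) v)`, where `N = defectForm K`. -/
noncomputable def relaxForm (K : E →ₗ[ℝ] E) (lam : ℝ) : LinearMap.BilinForm ℝ E :=
  (1 - lam) • defectForm K + (defectForm K).compl₁₂ LinearMap.id K

theorem relaxForm_apply (K : E →ₗ[ℝ] E) (lam : ℝ) (u v : E) :
    relaxForm K lam u v = (1 - lam) * defectForm K u v + defectForm K u (K v) := rfl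

variable {K : E →ₗ[ℝ] E}

theorem inner_map_self_le (hK : ∀ x, ‖K x‖ ^ 2 ≤ ⟪K x, x⟫) (x : E) : ⟪K x, x⟫ ≤ ‖x‖ ^ 2 := by
  have h := sq_nonneg ‖x - K x‖
  rw [norm_sub_sq_real, real_inner_comm] at h
  linarith [hK x]

theorem defectForm_comm (u v : E) : defectForm K u v = defectForm K v u := by
  rw [defectForm_apply, defectForm_apply, real_inner_comm, real_inner_comm (K v)]

theorem defectForm_self_nonneg (hK : ∀ x, ‖K x‖ ^ 2 ≤ ⟪K x, x⟫) (u : E) :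
    0 ≤ defectForm K u u := by
  rw [defectForm_apply, real_inner_self_eq_norm_sq, real_inner_self_eq_norm_sq]
  linarith [inner_map_self_le hK u, hK u]

theorem relaxForm_comm (hsym : K.IsSymmetric) {lam : ℝ} (u v : E) :
    relaxForm K lam u v = relaxForm K lam v u := by
  rw [relaxForm_apply, relaxForm_apply, defectForm_comm v u, defectForm_apply K u (K v),
    defectForm_apply K v (K u), ← hsym u v, ← hsym (K u) (K v), real_inner_comm (K u) v,
    real_inner_comm (K (K u))]

theorem relaxForm_self_nonneg (hK : ∀ x, ‖K x‖ ^ 2 ≤ ⟪K x, x⟫) {lam : ℝ} (hlam : lam ≤ 1)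
    (u : E) : 0 ≤ relaxForm K lam u u := by
  have h1 := mul_nonneg (sub_nonneg.2 hlam) (defectForm_self_nonneg hK u)
  have h2 := inner_map_self_le hK (K u)
  rw [relaxForm_apply, defectForm_apply K u (K u), real_inner_comm, real_inner_comm (K (K u))]
  linarith [hK u]

theorem defectForm_self_le (hK : ∀ x, ‖K x‖ ^ 2 ≤ ⟪K x, x⟫) (u : E) :
    defectForm K u u ≤ ‖u + K u‖ ^ 2 := by
  rw [defectForm_apply, real_inner_self_eq_norm_sq, real_inner_self_eq_norm_sq,
    norm_add_sq_real, real_inner_comm]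
  nlinarith [hK u, sq_nonneg ‖K u‖]

theorem injective_id_add (hK : ∀ x, ‖K x‖ ^ 2 ≤ ⟪K x, x⟫) :
    Function.Injective (LinearMap.id + K : E →ₗ[ℝ] E) := by
  rw [← LinearMap.ker_eq_bot, LinearMap.ker_eq_bot']
  intro x hx
  have h : K x = -x := by
    rw [LinearMap.add_apply, LinearMap.id_apply] at hx
    exact (neg_eq_of_add_eq_zero_right hx).symm
  have := hK x
  rw [h, norm_neg, inner_neg_left, real_inner_self_eq_norm_sq] at this
  have : ‖x‖ ^ 2 = 0 := le_antisymm (by linarith) (sq_nonneg _)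
  simpa using this

/-- Rate of the relaxed and extrapolated recursion in the variables `a`, where `Fz k` stands for
`F(z k)` and `Fs` for the value of `F` at `p`. The rate of the accelerated proximal point recursion
is applied to `F(z k) - Fs` increased by a multiple of `W(b k, b k)`. -/
theorem relaxed_rate (hsym : K.IsSymmetric) (hK : ∀ x, ‖K x‖ ^ 2 ≤ ⟪K x, x⟫)
    {γ lam : ℝ} (hγ : 0 < γ) (hlam0 : 0 < lam) (hlam : lam ≤ 1)
    {a b y z : ℕ → E} {p : E} {Fz : ℕ → ℝ} {Fs : ℝ}
    (hb : ∀ k, b k + K (b k) = z k - y k)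
    (ha : ∀ k, a (k + 1) = y k + lam • b k) (hy0 : y 0 = a 0)
    (hy : ∀ k, y (k + 1) = a (k + 1) + fastBeta k • (a (k + 1) - a k))
    (hstar : ∀ k, γ * (Fz k - Fs) ≤ defectForm K (b k) (p - z k))
    (hpair : ∀ k, γ * (Fz (k + 1) - Fz k) ≤ defectForm K (b (k + 1)) (z k - z (k + 1)))
    (N : ℕ) :
    Fz N - Fs ≤ 2 / (γ * lam * ((N : ℝ) + 2) ^ 2) * ‖(p - a 0) + K (p - a 0)‖ ^ 2 := by
  set W := relaxForm K lam with hW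
  have hz : ∀ k, z k = a (k + 1) + ((1 - lam) • b k + K (b k)) := by
    intro k
    rw [ha, ← sub_add_cancel (z k) (y k), ← hb k]
    module
  have hWz : ∀ u v, defectForm K u ((1 - lam) • v + K v) = W u v := by
    intro u v
    rw [map_add, map_smul, smul_eq_mul, hW, relaxForm_apply]
  have hd : ∀ k, a (k + 1) - y k = lam • b k := by
    intro k; rw [ha]; abel
  have key := accelerated_rate (B := defectForm K) defectForm_comm (defectForm_self_nonneg hK)
    (δ := fun k => lam * (γ * (Fz k - Fs) + W (b k) (b k) / 2)) (p := p) hy0 hy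
    (by
      intro k
      have h := hstar k
      rw [hz, ← sub_sub, map_sub, hWz] at h
      rw [hd, map_smul, LinearMap.smul_apply, smul_eq_mul]
      have := relaxForm_self_nonneg hK hlam (b k)
      exact mul_le_mul_of_nonneg_left (by linarith) hlam0.le)
    (by
      intro k
      have h := hpair k
      have e : z k - z (k + 1) = (a (k + 1) - a (k + 2))
          + (((1 - lam) • b k + K (b k)) - ((1 - lam) • b (k + 1) + K (b (k + 1)))) := by
        rw [hz, hz]; abel
      rw [e, map_add, map_sub _ ((1 - lam) • b k + K (b k)), hWz, hWz] at h
      rw [show a (k + 2) - y (k + 1) = lam • b (k + 1) from hd (k + 1), map_smul,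
        LinearMap.smul_apply, smul_eq_mul, ← mul_add]
      have hsq := relaxForm_self_nonneg hK hlam (b k - b (k + 1))
      rw [← hW] at hsq
      simp only [map_sub, LinearMap.sub_apply] at hsq
      rw [relaxForm_comm hsym (b k) (b (k + 1))] at hsq
      refine mul_le_mul_of_nonneg_left ?_ hlam0.le
      linarith) N
  have hWN := relaxForm_self_nonneg hK hlam (b N)
  have hD := defectForm_self_le hK (p - a 0)
  rw [← neg_sub p (a 0), map_neg, map_neg, LinearMap.neg_apply, neg_neg] at key
  have hN : 0 < ((N : ℝ) + 2) ^ 2 := by positivity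
  have hpos : 0 < γ * lam * ((N : ℝ) + 2) ^ 2 := by positivity
  rw [div_mul_eq_mul_div, le_div_iff₀ hpos]
  have : 0 ≤ ((N : ℝ) + 2) ^ 2 * (lam * W (b N) (b N)) := by positivity
  linarith

end Inner

/-! ### Proximal steps -/

section Prox

theorem nonneg_of_forall_small {c e : ℝ} (h : ∀ t : ℝ, 0 < t → t ≤ 1 → 0 ≤ t * c + t ^ 2 * e) :
    0 ≤ c := by
  have h1 : ∀ t : ℝ, 0 < t → t ≤ 1 → 0 ≤ c + t * e := fun t ht ht1 =>
    nonneg_of_mul_nonneg_right (a := t) (by linarith [h t ht ht1]) ht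
  have hlim : Filter.Tendsto (fun t : ℝ => c + t * e) (nhdsWithin 0 (Set.Ioi 0)) (nhds c) := by
    have : Continuous fun t : ℝ => c + t * e := by fun_prop
    simpa using (this.tendsto 0).mono_left nhdsWithin_le_nhds
  refine ge_of_tendsto hlim ?_
  filter_upwards [Ioc_mem_nhdsGT (zero_lt_one (α := ℝ))] with t ht using h1 t ht.1 ht.2

variable {n : ℕ} {γ : ℝ} {g : Rn n → EReal} {w z : Rn n}

theorem exists_real_of_mem_proxSet (hg : IsProperClosedConvex g) (hz : z ∈ proxSet γ g w) :
    ∃ r : ℝ, g z = r := by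
  obtain ⟨x₀, hx₀⟩ := hg.exists_ne_top
  refine ⟨(g z).toReal, (EReal.coe_toReal ?_ (hg.ne_bot z)).symm⟩
  intro htop
  have h := hz x₀
  simp only [htop, EReal.top_add_coe, top_le_iff] at h
  exact EReal.add_ne_top hx₀ (EReal.coe_ne_top _) h

/-- Optimality condition of a proximal step: `(w - z) / γ` is a subgradient of `g` at `z`. -/
theorem prox_subgradient (hg : IsProperClosedConvex g) (hγ : 0 < γ) (hz : z ∈ proxSet γ g w)
    {r s : ℝ} (hr : g z = r) {v : Rn n} (hs : g v ≤ s) :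
    γ * (r - s) ≤ ⟪z - w, v - z⟫ := by
  suffices h : 0 ≤ γ * (s - r) + ⟪z - w, v - z⟫ by linarith
  refine nonneg_of_forall_small (e := ‖v - z‖ ^ 2 / 2) fun t ht ht1 => ?_
  have hconv := hg.convex (x := (z, r)) hr.le (y := (v, s)) hs (sub_nonneg.2 ht1) ht.le
    (sub_add_cancel 1 t)
  have hpt : (1 - t) • z + t • v - w = (z - w) + t • (v - z) := by module
  have h := (hz ((1 - t) • z + t • v)).trans (add_le_add_left hconv _)
  simp only [hr, hpt, Prod.smul_mk, Prod.mk_add_mk, smul_eq_mul, ← EReal.coe_add,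
    EReal.coe_le_coe_iff] at h
  rw [norm_add_sq_real, norm_smul, inner_smul_right, mul_pow, Real.norm_eq_abs, sq_abs] at h
  have h2 := mul_le_mul_of_nonneg_left h hγ.le
  field_simp at h2
  linarith

end Prox

/-! ### The quadratic term -/

section Quadratic

variable {n : ℕ} (Q : Matrix (Fin n) (Fin n) ℝ) (q : Rn n)

theorem quadFun_eq (x : Rn n) : quadFun Q q x = 1 / 2 * ⟪Q.toEuclideanLin x, x⟫ + ⟪q, x⟫ := by
  rw [quadFun, EuclideanSpace.inner_eq_star_dotProduct, EuclideanSpace.inner_eq_star_dotProduct,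
    Matrix.ofLp_toLpLin, Matrix.toLin'_apply, dotProduct_comm q.ofLp]
  simp

variable {Q}

theorem quadFun_add (hQ : Q.PosSemidef) (x d : Rn n) : quadFun Q q (x + d) =
    quadFun Q q x + ⟪Q.toEuclideanLin x + q, d⟫ + 1 / 2 * ⟪Q.toEuclideanLin d, d⟫ := by
  have hsym := (Matrix.isPositive_toEuclideanLin_iff.2 hQ).isSymmetric
  simp only [quadFun_eq, map_add, inner_add_left, inner_add_right]
  rw [hsym d x, real_inner_comm d]
  ring

theorem inner_toEuclideanLin_nonneg (hQ : Q.PosSemidef) (x : Rn n) :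
    0 ≤ ⟪Q.toEuclideanLin x, x⟫ :=
  (Matrix.isPositive_toEuclideanLin_iff.2 hQ).inner_nonneg_left x

/-- Optimality condition of a proximal step on the quadratic: `u = y + γ ∇f(y)`. -/
theorem prox_quadFun_eq (hQ : Q.PosSemidef) {γ : ℝ} (hγ : 0 < γ) {u y : Rn n}
    (hy : y ∈ proxSet γ (quadFunE Q q) u) : u = y + γ • Q.toEuclideanLin y + γ • q := by
  set v := y - u + γ • (Q.toEuclideanLin y + q) with hv
  have hd : ∀ d, 0 ≤ ⟪v, d⟫ := by
    intro d
    refine nonneg_of_forall_small (e := γ / 2 * ⟪Q.toEuclideanLin d, d⟫ + ‖d‖ ^ 2 / 2)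
      fun t ht _ => ?_
    have h := hy (y + t • d)
    simp only [quadFunE, ← EReal.coe_add, EReal.coe_le_coe_iff, quadFun_add q hQ] at h
    rw [show y + t • d - u = (y - u) + t • d by abel, norm_add_sq_real, norm_smul, mul_pow,
      Real.norm_eq_abs, sq_abs, map_smul, inner_smul_left, inner_smul_right, inner_smul_right,
      inner_smul_right] at h
    rw [hv, inner_add_left, inner_smul_left]
    have h2 := mul_le_mul_of_nonneg_left h hγ.le
    simp only [conj_trivial] at h2 ⊢
    field_simp at h2
    linarith
  have h0 : v = 0 := by
    have := hd (-v)
    rw [inner_neg_right] at this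
    exact (real_inner_self_nonpos).1 (by linarith)
  have : u = y + γ • (Q.toEuclideanLin y + q) - v := by rw [hv]; abel
  rw [this, h0]
  module

theorem lambdaMax_nonneg (hQ : Q.PosSemidef) : 0 ≤ lambdaMax Q := by
  refine Real.sSup_nonneg fun r hr => ?_
  rw [hQ.1.spectrum_real_eq_range_eigenvalues] at hr
  obtain ⟨i, rfl⟩ := hr
  exact hQ.eigenvalues_nonneg i

open scoped MatrixOrder in
theorem inner_toEuclideanLin_le (hQ : Q.PosSemidef) (x : Rn n) :
    ⟪Q.toEuclideanLin x, x⟫ ≤ lambdaMax Q * ‖x‖ ^ 2 := by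
  have hsa : IsSelfAdjoint Q := hQ.1
  have hle : Q ≤ algebraMap ℝ _ (lambdaMax Q) :=
    le_algebraMap_of_spectrum_le (fun r hr => le_csSup Q.finite_real_spectrum.bddAbove hr) hsa
  have h := inner_toEuclideanLin_nonneg (Matrix.le_iff.1 hle) x
  rw [map_sub, LinearMap.sub_apply, inner_sub_left, sub_nonneg, Algebra.algebraMap_eq_smul_one,
    map_smul, LinearMap.smul_apply, inner_smul_left] at h
  simpa [Matrix.toLpLin_one, real_inner_self_eq_norm_sq] using h

/-- The operator `γQ` is firmly nonexpansive; this follows from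
`0 ≤ ⟪Q (x - γ Q x), x - γ Q x⟫` and `γ⟪Q (Q x), Q x⟫ ≤ ‖Q x‖²`. -/
theorem norm_sq_toEuclideanLin_le (hQ : Q.PosSemidef) {γ : ℝ} (hγ : 0 < γ)
    (hγL : γ * lambdaMax Q < 1) (x : Rn n) :
    ‖(γ • Q.toEuclideanLin) x‖ ^ 2 ≤ ⟪(γ • Q.toEuclideanLin) x, x⟫ := by
  set T := Q.toEuclideanLin
  have hsym : T.IsSymmetric := (Matrix.isPositive_toEuclideanLin_iff.2 hQ).isSymmetric
  have h := inner_toEuclideanLin_nonneg hQ (x - γ • T x)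
  have hle := inner_toEuclideanLin_le hQ (T x)
  have hsq := mul_le_mul_of_nonneg_right hγL.le (mul_nonneg hγ.le (sq_nonneg ‖T x‖))
  have hle' := mul_le_mul_of_nonneg_left hle (sq_nonneg γ)
  simp only [map_sub, map_smul, inner_sub_left, inner_sub_right, inner_smul_left,
    inner_smul_right, conj_trivial] at h
  rw [hsym (T x) x, real_inner_self_eq_norm_sq] at h
  rw [LinearMap.smul_apply, norm_smul, mul_pow, Real.norm_eq_abs, sq_abs, inner_smul_left,
    conj_trivial]
  have : 0 ≤ ⟪T x, x⟫ - γ * ‖T x‖ ^ 2 := by linarith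
  have := mul_nonneg hγ.le this
  linarith

/-- The key inequality for a pair of proximal steps `u ↦ y ↦ z`: up to the factor `γ`, the objective
`F` lies above an affine function touching it at `z`, whose slope is represented by
`b = (1 + γQ)⁻¹ (z - y)` in the metric `defectForm (γQ)`. -/
theorem objective_sub_le (hQ : Q.PosSemidef) {γ : ℝ} (hγ : 0 < γ) {g : Rn n → EReal}
    (hg : IsProperClosedConvex g) {u y z b v : Rn n} (hy : y ∈ proxSet γ (quadFunE Q q) u)
    (hz : z ∈ proxSet γ g ((2 : ℝ) • y - u)) (hb : b + (γ • Q.toEuclideanLin) b = z - y)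
    {r s : ℝ} (hr : g z = r) (hs : g v ≤ s) :
    γ * ((quadFun Q q z + r) - (quadFun Q q v + s)) ≤
      defectForm (γ • Q.toEuclideanLin) b (v - z) := by
  have hsub := prox_subgradient hg hγ hz hr hs
  have hquad := quadFun_add q hQ z (v - z)
  have hnn := mul_nonneg hγ.le (inner_toEuclideanLin_nonneg hQ (v - z))
  have hu := prox_quadFun_eq q hQ hγ hy
  set K := γ • Q.toEuclideanLin
  have hsym : K.IsSymmetric :=
    (Matrix.isPositive_toEuclideanLin_iff.2 hQ).isSymmetric.smul (by simp)
  have hKT : ∀ x, γ • Q.toEuclideanLin x = K x := fun _ => rfl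
  have hKb : K b + K (K b) = K z - K y := by rw [← map_add, hb, map_sub]
  rw [hKT] at hu
  have e : z - ((2 : ℝ) • y - u) - (K z + γ • q) = b - K (K b) := by
    have : z - ((2 : ℝ) • y - u) - (K z + γ • q) = (z - y) - (K z - K y) := by
      rw [hu]; module
    rw [this, ← hb, ← hKb]; abel
  rw [defectForm_apply, ← hsym (K b), ← inner_sub_left, ← e, inner_sub_left]
  rw [← hKT z, ← smul_add, inner_smul_left, conj_trivial]
  rw [add_sub_cancel] at hquad
  rw [hquad]
  linarith

end Quadratic

/-! ### The rate of convergence -/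

theorem theorem5 {n : ℕ} (Q : Matrix (Fin n) (Fin n) ℝ) (hQ : Q.PosSemidef) (q : Rn n)
    (g : Rn n → EReal) (hg : IsProperClosedConvex g)
    (hX : (argminSet fun w => quadFunE Q q w + g w).Nonempty)
    (γ : ℝ) (hγ : 0 < γ) (hγL : γ * lambdaMax Q < 1)
    (x u y z : ℕ → Rn n)
    (hiter : IsFastDRS (quadFunE Q q) g γ (fun _ => drsStep γ (lambdaMax Q)) fastBeta x u y z)
    (xt : Rn n) (hxt : xt ∈ drsFixedSet γ (quadFunE Q q) g) (k : ℕ) :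
    (quadFunE Q q (z k) + g (z k)) - (⨅ w, (quadFunE Q q w + g w)) ≤
      ((2 / (γ * drsStep γ (lambdaMax Q) * ((k : ℝ) + 2) ^ 2) * ‖x 0 - xt‖ ^ 2 : ℝ) : EReal) := by
  set K := γ • Q.toEuclideanLin
  have hKT : ∀ v, γ • Q.toEuclideanLin v = K v := fun _ => rfl
  have hsym : K.IsSymmetric :=
    (Matrix.isPositive_toEuclideanLin_iff.2 hQ).isSymmetric.smul (by simp)
  have hK := norm_sq_toEuclideanLin_le hQ hγ hγL
  have hγL0 : 0 ≤ γ * lambdaMax Q := mul_nonneg hγ.le (lambdaMax_nonneg hQ)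
  set lam := drsStep γ (lambdaMax Q)
  have hlam0 : 0 < lam := div_pos (by linarith) (by linarith)
  have hlam1 : lam ≤ 1 := div_le_one_of_le₀ (by linarith) (by linarith)
  have hinj := injective_id_add hK
  have hsurj := LinearMap.injective_iff_surjective.1 hinj
  obtain ⟨p, hpf, hpg⟩ := hxt
  obtain ⟨rp, hrp⟩ := exists_real_of_mem_proxSet hg hpg
  choose rz hrz using fun k => exists_real_of_mem_proxSet hg (hiter.z_step k)
  choose b hb using fun k => hsurj (z k - y k)
  simp only [LinearMap.add_apply, LinearMap.id_apply] at hb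
  -- A fixed point has `y = z = p`, so the key inequality with `b = 0` says that `p` minimizes `F`.
  have hpmin : ∀ (v : Rn n) (s : ℝ), g v ≤ s → quadFun Q q p + rp ≤ quadFun Q q v + s := by
    intro v s hs
    have h := objective_sub_le q hQ hγ hg hpf hpg (b := 0) (by simp) hrp hs
    rw [map_zero, LinearMap.zero_apply] at h
    exact sub_nonpos.1 (nonpos_of_mul_nonpos_right h hγ)
  have hinf : (⨅ w, (quadFunE Q q w + g w)) = ((quadFun Q q p + rp : ℝ) : EReal) := by
    refine le_antisymm ((iInf_le _ p).trans_eq ?_) (le_iInf fun v => ?_)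
    · rw [hrp, quadFunE, EReal.coe_add]
    · by_cases htop : g v = ⊤
      · simp [htop, quadFunE]
      · have hv := (EReal.coe_toReal htop (hg.ne_bot v)).symm
        rw [hv, quadFunE, ← EReal.coe_add, EReal.coe_le_coe_iff]
        exact hpmin v _ hv.le
  rw [hinf, hrz, quadFunE, ← EReal.coe_add, ← EReal.coe_sub, EReal.coe_le_coe_iff]
  have hu := fun k => prox_quadFun_eq q hQ hγ (hiter.y_step k)
  have hxp := prox_quadFun_eq q hQ hγ hpf
  simp only [hKT] at hu hxp
  -- `a k` is the preimage of `x k` under `v ↦ v + K v + γ • q`.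
  let a : ℕ → Rn n := fun k => Nat.casesOn k (y 0) fun j => y j + lam • b j
  have hax : ∀ k, x k = a k + K (a k) + γ • q := by
    rintro (_ | k)
    · exact hiter.init.symm.trans (hu 0)
    · rw [hiter.x_step, hu, ← hb]
      simp only [a, map_add, map_smul]
      module
  have hy : ∀ k, y (k + 1) = a (k + 1) + fastBeta k • (a (k + 1) - a k) := by
    intro k
    apply hinj
    have h := hiter.u_step k
    rw [hu, hax (k + 1), hax k] at h
    simp only [LinearMap.add_apply, LinearMap.id_apply, map_add, map_smul, map_sub]
    rw [← sub_eq_zero] at h ⊢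
    rw [← h]
    module
  have key := relaxed_rate hsym hK hγ hlam0 hlam1 (a := a) (Fz := fun k => quadFun Q q (z k) + rz k)
    (Fs := quadFun Q q p + rp) (p := p) hb (fun _ => rfl) rfl hy
    (fun k => objective_sub_le q hQ hγ hg (hiter.y_step k) (hiter.z_step k) (hb k) (hrz k) hrp.le)
    (fun k => objective_sub_le q hQ hγ hg (hiter.y_step (k + 1)) (hiter.z_step (k + 1))
      (hb (k + 1)) (hrz (k + 1)) (hrz k).le) k
  have hdist : (p - a 0) + K (p - a 0) = xt - x 0 := by
    rw [hxp, hax 0, map_sub]; abel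
  rw [hdist, norm_sub_rev] at key
  exact key
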